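/- Let $p\colon X\to Y$ be a continuous map of (arbitrary) topological spaces. Then $p$ is a homotopy equivalence if and only if it has the homotopy extension lifting property (HELP) with respect to every closed cofibration $i\colon A\to B$ of topological spaces. Here $i\colon A\to B$ is a closed cofibration if $i(A)$ is closed in $B$ and $i$ has the homotopy extension property: for every space $Z$, every continuous map $f\colon B\to Z$ and every homotopy $H\colon [0,1]\times A\to Z$ with $H(0,a)=f(i(a))$ for all $a \in A$, there is a homotopy $K\colon [0,1]\times B\to Z$ with $K(0,b)=f(b)$ for all $b \in B$ and $K(t,i(a))=H(t,a)$ for all $t \in [0,1]$, $a \in A$. The map $p$ has the HELP with respect to $i$ if for all continuous maps $f_A\colon A\to X$ and $g\colon B\to Y$ and every homotopy $h_A\colon [0,1]\times A\to Y$ from $p\circ f_A$ to $g\circ i$ there are a continuous map $f\colon B\to X$ and a homotopy $h\colon [0,1]\times B\to Y$ from $p\circ f$ to $g$ such that $f\circ i=f_A$ and $h(t,i(a))=h_A(t,a)$ for all $t \in [0,1]$ and $a\in A$. -/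

import Mathlib

universe u

open scoped unitInterval

/-- `p : X → Y` is a homotopy equivalence: it is the underlying map of a homotopy equivalence, i.e.
it has a two-sided inverse up to homotopy. -/
def IsHomotopyEquivalence {X Y : Type u} [TopologicalSpace X] [TopologicalSpace Y]
    (p : C(X, Y)) : Prop :=
  ∃ e : ContinuousMap.HomotopyEquiv X Y, e.toFun = p

/-- `i : A → B` is a (Hurewicz) cofibration: it has the homotopy extension property
with respect to every topological space `Z`. -/
def IsHurewiczCofibration {A B : Type u} [TopologicalSpace A] [TopologicalSpace B]
    (i : C(A, B)) : Prop :=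
  ∀ (Z : Type u) [TopologicalSpace Z] (f : C(B, Z)) (H : C(I × A, Z)),
    (∀ a : A, H (0, a) = f (i a)) →
      ∃ K : C(I × B, Z), (∀ b : B, K (0, b) = f b) ∧ ∀ (t : I) (a : A), K (t, i a) = H (t, a)

/-- A closed cofibration: a cofibration whose image is closed. -/
structure IsClosedCofibration {A B : Type u} [TopologicalSpace A] [TopologicalSpace B]
    (i : C(A, B)) : Prop where
  cofibration : IsHurewiczCofibration i
  isClosed_range : IsClosed (Set.range i)

/-- `p : X → Y` has the homotopy extension lifting property with respect to `i : A → B`: for every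
not necessarily commutative square `fA : A → X`, `g : B → Y` and every homotopy `hA` from `p ∘ fA`
to `g ∘ i`, there are `f : B → X` and a homotopy `h` from `p ∘ f` to `g` which extend `fA` and
`hA` along `i`. -/
def HasHELP {X Y A B : Type u} [TopologicalSpace X] [TopologicalSpace Y]
    [TopologicalSpace A] [TopologicalSpace B] (p : C(X, Y)) (i : C(A, B)) : Prop :=
  ∀ (fA : C(A, X)) (g : C(B, Y)) (hA : ContinuousMap.Homotopy (p.comp fA) (g.comp i)),
    ∃ (f : C(B, X)) (h : ContinuousMap.Homotopy (p.comp f) g),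
      f.comp i = fA ∧ ∀ (t : I) (a : A), h (t, i a) = hA (t, a)

/-!
Both directions rest on the three-sided boundary `J` of the square `I × I` (the bottom and the two
vertical sides), onto which the square retracts.

If `p` has the HELP, then applying it to `∅ → Y` yields a right homotopy inverse `f` of `p` with a
homotopy `h : p ∘ f ≃ id`, and applying it to the inclusion of the two ends `X ⊕ X → I × X` (with
`f ∘ p` and `id` on the ends, `p ∘ pr` on the cylinder, and `h ∘ p` and the constant homotopy
comparing them in `Y`) yields a homotopy `f ∘ p ≃ id`. The inclusion of the ends is a closed
cofibration by the retraction onto `J`.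

Conversely, let `q` be a homotopy inverse of `p`. The main tool is
`IsHurewiczCofibration.exists_top_of_square`: given a square of homotopies on `A`, of which three
sides are extended over `B`, the fourth side extends over `B` with the prescribed ends. It lets one
replace compositions of homotopies up to homotopy by strict equalities on `A`, and no coherence
between the homotopies `q ∘ p ≃ id` and `p ∘ q ≃ id` is needed. The homotopy `q ∘ hA` is first
realised over `B` as a homotopy `q ∘ p ∘ f ≃ q ∘ g` with `f` extending `fA`
(`IsHurewiczCofibration.exists_lift_of_homotopy_id` changes a map into one of the form `q ∘ p ∘ f`
relative to `A`). Its image under `p` is then the bottom of a square whose vertical sides come from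
`p ∘ q ≃ id`, and whose restriction to `A` is `p ∘ q ≃ id` applied to `hA`; the top of that square
is the homotopy wanted.
-/

/-! ### The three-sided boundary of the square -/

/-- The union of the bottom side and the two vertical sides of the square. The first coordinate is
the horizontal one. -/
def squareSides : Set (I × I) := {z | z.2 = 0 ∨ z.1 = 0 ∨ z.1 = 1}

/-- Homotopies prescribed on the three sides and agreeing at the two bottom corners glue. -/
theorem exists_glue_squareSides {B Z : Type u} [TopologicalSpace B] [TopologicalSpace Z]
    (bot left right : C(I × B, Z)) (h₀ : ∀ b, left (0, b) = bot (0, b))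
    (h₁ : ∀ b, right (0, b) = bot (1, b)) :
    ∃ F : C(squareSides × B, Z),
      (∀ (z : squareSides) b, z.1.2 = 0 → F (z, b) = bot (z.1.1, b)) ∧
      (∀ (z : squareSides) b, z.1.1 = 0 → F (z, b) = left (z.1.2, b)) ∧
      (∀ (z : squareSides) b, z.1.1 = 1 → F (z, b) = right (z.1.2, b)) := by
  -- On the three sides, `3 * s ≤ t` holds exactly on the left one and `3 * (1 - s) ≤ t` exactly on
  -- the right one, with equality only at the bottom corners.
  let F : squareSides × B → Z := fun w =>
    if 3 * (w.1.1.1 : ℝ) ≤ w.1.1.2 then left (w.1.1.2, w.2)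
    else if 3 * (1 - (w.1.1.1 : ℝ)) ≤ w.1.1.2 then right (w.1.1.2, w.2)
    else bot (w.1.1.1, w.2)
  have hF : Continuous F := by
    refine Continuous.if_le (by fun_prop) (Continuous.if_le (by fun_prop) (by fun_prop)
      (by fun_prop) (by fun_prop) ?_) (by fun_prop) (by fun_prop) ?_
    · rintro ⟨⟨⟨s, t⟩, hz⟩, b⟩ h
      have hs := s.2.1; have hs' := s.2.2; have ht := t.2.1; have ht' := t.2.2
      dsimp only at h ⊢
      rcases hz with rfl | hz | hz
      · have : s = 1 := Subtype.ext (by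
            simp only [Set.Icc.coe_zero, Set.Icc.coe_one] at h ⊢; linarith)
        subst this; exact h₁ b
      · simp only at hz; subst hz; simp at h; linarith
      · simp only at hz; subst hz
        have : t = 0 := Subtype.ext (by
            simp only [Set.Icc.coe_zero, Set.Icc.coe_one] at h ⊢; linarith)
        subst this; exact h₁ b
    · rintro ⟨⟨⟨s, t⟩, hz⟩, b⟩ h
      have hs := s.2.1; have hs' := s.2.2; have ht := t.2.1; have ht' := t.2.2
      dsimp only at h ⊢
      have hst : s = 0 ∧ t = 0 := by
        rcases hz with rfl | hz | hz
        · exact ⟨Subtype.ext (by simp only [Set.Icc.coe_zero] at h ⊢; linarith), rfl⟩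
        · simp only at hz; subst hz
          exact ⟨rfl, Subtype.ext (by simp only [Set.Icc.coe_zero] at h ⊢; linarith)⟩
        · simp only at hz; subst hz; simp at h; linarith
      obtain ⟨rfl, rfl⟩ := hst
      simp [h₀ b]
  refine ⟨⟨F, hF⟩, ?_, ?_, ?_⟩
  · rintro ⟨⟨s, t⟩, hz⟩ b rfl
    have hs := s.2.1; have hs' := s.2.2
    simp only [ContinuousMap.coe_mk, F]
    split_ifs with h h'
    · have : s = 0 := Subtype.ext (by simp only [Set.Icc.coe_zero] at h ⊢; linarith)
      subst this; exact h₀ b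
    · have : s = 1 := Subtype.ext (by
            simp only [Set.Icc.coe_zero, Set.Icc.coe_one] at h' ⊢; linarith)
      subst this; exact h₁ b
    · rfl
  · rintro ⟨⟨s, t⟩, hz⟩ b rfl
    have ht := t.2.1
    simp only [ContinuousMap.coe_mk, F]
    rw [if_pos (by simpa using ht)]
  · rintro ⟨⟨s, t⟩, hz⟩ b rfl
    have ht := t.2.1; have ht' := t.2.2
    simp only [ContinuousMap.coe_mk, F]
    rw [if_neg (by simp; linarith), if_pos (by simpa using ht)]

/-- A retraction of the square onto the union of its bottom and vertical sides. Points with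
`3 * s ≤ t` go to the left side, points with `3 * (1 - s) ≤ t` to the right one and all others to
the bottom. -/
noncomputable def squareRetraction : C(I × I, squareSides) where
  toFun z := ⟨(Set.projIcc 0 1 zero_le_one ((z.1 : ℝ) + (2 * z.1 - 1) * z.2),
      Set.projIcc 0 1 zero_le_one (z.2 - 3 * min (z.1 : ℝ) (1 - z.1))), by
    obtain ⟨⟨s, hs, hs'⟩, ⟨t, ht, ht'⟩⟩ := z
    simp only [squareSides, Set.mem_ofPred_eq]
    by_cases h : t ≤ 3 * min s (1 - s)
    · exact Or.inl (Set.projIcc_of_le_left _ (by linarith))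
    · rcases le_total s (1 - s) with h' | h'
      · rw [min_eq_left h'] at h
        exact Or.inr (Or.inl (Set.projIcc_of_le_left _ (by nlinarith)))
      · rw [min_eq_right h'] at h
        exact Or.inr (Or.inr (Set.projIcc_of_right_le _ (by nlinarith)))⟩
  continuous_toFun := by
    refine Continuous.subtype_mk (Continuous.prodMk ?_ ?_) _ <;>
      exact continuous_projIcc.comp (by fun_prop)

theorem squareRetraction_of_mem {z : I × I} (hz : z ∈ squareSides) :
    squareRetraction z = ⟨z, hz⟩ := by
  obtain ⟨s, t⟩ := z
  refine Subtype.ext (Prod.ext ?_ ?_) <;> simp only [squareRetraction, ContinuousMap.coe_mk]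
  · rcases hz with h | h | h <;> simp only at h <;> subst h
    · simp
    · exact Set.projIcc_of_le_left _ (by simpa using t.2.1)
    · exact Set.projIcc_of_right_le _ (by simpa using by linarith [t.2.1])
  · rcases hz with h | h | h <;> simp only at h <;> subst h
    · exact Set.projIcc_of_le_left _ (by
        have := le_min s.2.1 (sub_nonneg.2 s.2.2); simp only [Set.Icc.coe_zero]; linarith)
    · simp
    · simp

/-! ### Cofibrations -/

theorem isClosedCofibration_of_isEmpty {A B : Type u} [TopologicalSpace A] [TopologicalSpace B]
    [IsEmpty A] (i : C(A, B)) : IsClosedCofibration i where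
  cofibration _ _ f _ _ := ⟨f.comp ContinuousMap.snd, fun _ => rfl, fun _ => isEmptyElim⟩
  isClosed_range := by simp [Set.range_eq_empty]

/-- The inclusion of the two ends of a cylinder. -/
def cylinderEnds (X : Type u) [TopologicalSpace X] : C(X ⊕ X, I × X) where
  toFun := Sum.elim (fun x => (0, x)) (fun x => (1, x))
  continuous_toFun := by fun_prop

theorem isClosedCofibration_cylinderEnds (X : Type u) [TopologicalSpace X] :
    IsClosedCofibration (cylinderEnds X) where
  cofibration Z _ f H hH := by
    obtain ⟨F, hbot, hleft, hright⟩ := exists_glue_squareSides f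
      (H.comp ⟨fun w : I × X => (w.1, Sum.inl w.2), by fun_prop⟩)
      (H.comp ⟨fun w : I × X => (w.1, Sum.inr w.2), by fun_prop⟩)
      (fun x => hH (Sum.inl x)) (fun x => hH (Sum.inr x))
    refine ⟨F.comp ⟨fun w : I × (I × X) => (squareRetraction (w.2.1, w.1), w.2.2),
      by fun_prop⟩, ?_, ?_⟩
    · rintro ⟨s, x⟩
      have hz : (s, (0 : I)) ∈ squareSides := Or.inl rfl
      simp only [ContinuousMap.comp_apply, ContinuousMap.coe_mk, squareRetraction_of_mem hz]
      exact hbot _ _ rfl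
    · rintro t (x | x)
      · have hz : ((0 : I), t) ∈ squareSides := Or.inr (Or.inl rfl)
        simp only [cylinderEnds, ContinuousMap.comp_apply, ContinuousMap.coe_mk, Sum.elim_inl,
          squareRetraction_of_mem hz]
        exact hleft _ _ rfl
      · have hz : ((1 : I), t) ∈ squareSides := Or.inr (Or.inr rfl)
        simp only [cylinderEnds, ContinuousMap.comp_apply, ContinuousMap.coe_mk, Sum.elim_inr,
          squareRetraction_of_mem hz]
        exact hright _ _ rfl
  isClosed_range := by
    have : Set.range (cylinderEnds X) = {w | w.1 = 0} ∪ {w | w.1 = 1} := by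
      ext ⟨s, x⟩
      simp [cylinderEnds, eq_comm]
    rw [this]
    exact (isClosed_eq continuous_fst continuous_const).union
      (isClosed_eq continuous_fst continuous_const)

section

variable {A B : Type u} [TopologicalSpace A] [TopologicalSpace B] {i : C(A, B)}

/-- The product of a cofibration with the interval is a cofibration: replace the target `Z` by
`C(I, Z)`. -/
theorem IsHurewiczCofibration.exists_extension_cylinder (hi : IsHurewiczCofibration i)
    {Z : Type u} [TopologicalSpace Z] (f : C(I × B, Z)) (H : C(I × (I × A), Z))
    (hH : ∀ s a, H (0, s, a) = f (s, i a)) :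
    ∃ K : C(I × (I × B), Z), (∀ s b, K (0, s, b) = f (s, b)) ∧
      ∀ u s a, K (u, s, i a) = H (u, s, a) := by
  let f' : C(B, C(I, Z)) := (f.comp ⟨Prod.swap, continuous_swap⟩).curry
  let H' : C(I × A, C(I, Z)) :=
    (H.comp ⟨fun w : (I × A) × I => (w.1.1, w.2, w.1.2), by fun_prop⟩).curry
  obtain ⟨K, hK, hK'⟩ := hi _ f' H' fun a => ContinuousMap.ext fun s => hH s a
  refine ⟨K.uncurry.comp ⟨fun w : I × (I × B) => ((w.1, w.2.2), w.2.1), by fun_prop⟩, ?_, ?_⟩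
  · exact fun s b => congrArg (fun φ : C(I, Z) => φ s) (hK b)
  · exact fun u s a => congrArg (fun φ : C(I, Z) => φ s) (hK' u a)

/-- If three sides of a square `S` of homotopies on `A` extend to homotopies on `B` which fit
together, then the top side extends to a homotopy on `B` joining the free ends of the vertical
sides. The arguments of `S` are the horizontal coordinate, the vertical one and the point of `A`. -/
theorem IsHurewiczCofibration.exists_top_of_square (hi : IsHurewiczCofibration i)
    {Z : Type u} [TopologicalSpace Z] (bot left right : C(I × B, Z)) (S : C(I × (I × A), Z))
    (h₀ : ∀ b, left (0, b) = bot (0, b)) (h₁ : ∀ b, right (0, b) = bot (1, b))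
    (hbot : ∀ s a, S (s, 0, a) = bot (s, i a)) (hleft : ∀ t a, S (0, t, a) = left (t, i a))
    (hright : ∀ t a, S (1, t, a) = right (t, i a)) :
    ∃ top : C(I × B, Z), (∀ b, top (0, b) = left (1, b)) ∧ (∀ b, top (1, b) = right (1, b)) ∧
      ∀ s a, top (s, i a) = S (s, 1, a) := by
  obtain ⟨F, Fbot, Fleft, Fright⟩ := exists_glue_squareSides bot left right h₀ h₁
  have hFS : ∀ (z : squareSides) a, S (z.1.1, z.1.2, a) = F (z, i a) := by
    rintro ⟨⟨s, t⟩, hz⟩ a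
    rcases id hz with h | h | h
    · rw [Fbot _ _ h, ← hbot]; simp only at h; subst h; rfl
    · rw [Fleft _ _ h, ← hleft]; simp only at h; subst h; rfl
    · rw [Fright _ _ h, ← hright]; simp only at h; subst h; rfl
  -- The retraction moves each coordinate of the point `(s, 1)` of the top side by at most `τ s`.
  -- Each coordinate of `v (·, s)` moves at speed at most one from the retracted point to `(s, 1)`,
  -- and has arrived at time `τ s`. Since `τ` vanishes at the ends, nothing changes there.
  let r : C(I, squareSides) := squareRetraction.comp ⟨fun s => (s, 1), by fun_prop⟩
  let τ : C(I, I) := ⟨fun s => Set.projIcc 0 1 zero_le_one (3 * min (s : ℝ) (1 - s)),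
    continuous_projIcc.comp (by fun_prop)⟩
  let v : C(I × I, I × I) :=
    ⟨fun w =>
      (Set.projIcc 0 1 zero_le_one
          (max (((r w.2).1.1 : ℝ) - w.1) (min (w.2 : ℝ) ((r w.2).1.1 + w.1))),
        Set.projIcc 0 1 zero_le_one (((r w.2).1.2 : ℝ) + w.1)),
      Continuous.prodMk (continuous_projIcc.comp (by fun_prop))
        (continuous_projIcc.comp (by fun_prop))⟩
  have hv0 : ∀ s, v (0, s) = (r s).1 := by
    intro s
    refine Prod.ext ?_ ?_ <;> simp [v]
  have hvτ : ∀ s, v (τ s, s) = (s, 1) := by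
    intro s
    have hs := s.2.1; have hs' := s.2.2
    have hr1 : ((r s).1.1 : ℝ) = max 0 (min 1 (3 * (s : ℝ) - 1)) := by
      simp only [r, squareRetraction, ContinuousMap.comp_apply, ContinuousMap.coe_mk,
        Set.coe_projIcc, Set.Icc.coe_one]
      ring_nf
    have hr2 : ((r s).1.2 : ℝ) = max 0 (min 1 (1 - 3 * min (s : ℝ) (1 - s))) := by
      simp only [r, squareRetraction, ContinuousMap.comp_apply, ContinuousMap.coe_mk,
        Set.coe_projIcc, Set.Icc.coe_one]
    have hτ : ((τ s : I) : ℝ) = max 0 (min 1 (3 * min (s : ℝ) (1 - s))) := by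
      simp only [τ, ContinuousMap.coe_mk, Set.coe_projIcc]
    refine Prod.ext (Subtype.ext ?_) (Subtype.ext ?_) <;>
      simp only [v, ContinuousMap.coe_mk, Set.coe_projIcc, Set.Icc.coe_one] <;>
      grind
  have hr : ∀ s, (s, (1 : I)) ∈ squareSides → (r s).1 = (s, 1) := fun s hs => by
    simp only [r, ContinuousMap.comp_apply, ContinuousMap.coe_mk, squareRetraction_of_mem hs]
  obtain ⟨K, hK, hK'⟩ := hi.exists_extension_cylinder
    (F.comp ⟨fun w : I × B => (r w.1, w.2), by fun_prop⟩)
    (S.comp ⟨fun w : I × (I × A) => ((v (w.1, w.2.1)).1, (v (w.1, w.2.1)).2, w.2.2),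
      by fun_prop⟩)
    (fun s a => by
      simp only [ContinuousMap.comp_apply, ContinuousMap.coe_mk, hv0]
      exact hFS _ _)
  refine ⟨K.comp ⟨fun w : I × B => (τ w.1, w.1, w.2), by fun_prop⟩, ?_, ?_, ?_⟩
  · intro b
    have h0 : τ 0 = 0 := Set.projIcc_of_le_left zero_le_one (by simp)
    have hr0 := hr 0 (Or.inr (Or.inl rfl))
    simp only [ContinuousMap.comp_apply, ContinuousMap.coe_mk, h0, hK]
    rw [Fleft _ _ (by rw [hr0]), hr0]
  · intro b
    have h1 : τ 1 = 0 := Set.projIcc_of_le_left zero_le_one (by simp)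
    have hr1 := hr 1 (Or.inr (Or.inr rfl))
    simp only [ContinuousMap.comp_apply, ContinuousMap.coe_mk, h1, hK]
    rw [Fright _ _ (by rw [hr1]), hr1]
  · intro s a
    simp only [ContinuousMap.comp_apply, ContinuousMap.coe_mk, hK', hvτ]

/-! ### Homotopy equivalences have the HELP -/

/-- A self-map `r` homotopic to the identity has the HELP for those squares which commute strictly:
a map `f₁` on `B` agreeing with `r ∘ fA` on `A` is homotopic relative to `A` to a map of the form
`r ∘ f` with `f` extending `fA`. -/
theorem IsHurewiczCofibration.exists_lift_of_homotopy_id (hi : IsHurewiczCofibration i)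
    {X : Type u} [TopologicalSpace X] {r : C(X, X)} (G : r.Homotopy (ContinuousMap.id X))
    (fA : C(A, X)) (f₁ : C(B, X)) (hf₁ : ∀ a, f₁ (i a) = r (fA a)) :
    ∃ (f : C(B, X)) (l : C(I × B, X)), (∀ a, f (i a) = fA a) ∧ (∀ b, l (0, b) = f₁ b) ∧
      (∀ b, l (1, b) = r (f b)) ∧ ∀ s a, l (s, i a) = r (fA a) := by
  obtain ⟨K, hK, hK'⟩ := hi X f₁ ⟨fun w : I × A => G (w.1, fA w.2), by fun_prop⟩
    (fun a => by simp [hf₁])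
  simp only [ContinuousMap.coe_mk] at hK'
  let f : C(B, X) := K.comp ⟨fun b => (1, b), by fun_prop⟩
  have hf : ∀ a, f (i a) = fA a := fun a => by simp [f, hK']
  -- On `A`, the path `G` followed by its inverse is contracted by the square `G (min s (1 - t))`.
  obtain ⟨l, hl0, hl1, hlA⟩ := hi.exists_top_of_square K
    (f₁.comp ContinuousMap.snd) ⟨fun w : I × B => G (σ w.1, f w.2), by fun_prop⟩
    ⟨fun w : I × (I × A) => G (min w.1 (σ w.2.1), fA w.2.2), by fun_prop⟩
    (fun b => by simp [hK]) (fun b => by simp [f])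
    (fun s a => by simp [hK', unitInterval.le_one'])
    (fun t a => by simp [hf₁])
    (fun t a => by simp [hf, unitInterval.le_one'])
  refine ⟨f, l, hf, fun b => by simp [hl0], fun b => by simp [hl1], fun s a => ?_⟩
  simp [hlA]

theorem IsHurewiczCofibration.hasHELP (hi : IsHurewiczCofibration i) {X Y : Type u}
    [TopologicalSpace X] [TopologicalSpace Y] {p : C(X, Y)} (hp : IsHomotopyEquivalence p) :
    HasHELP p i := by
  obtain ⟨⟨p', q, ⟨G⟩, ⟨H⟩⟩, hp⟩ := hp
  obtain rfl : p' = p := hp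
  intro fA g hA
  -- Extend the reverse of `q ∘ hA` from `q ∘ g`.
  obtain ⟨K, hK, hK'⟩ := hi X (q.comp g) ⟨fun w : I × A => q (hA (σ w.1, w.2)), by fun_prop⟩
    (fun a => by simp)
  simp only [ContinuousMap.coe_mk, ContinuousMap.comp_apply] at hK hK'
  obtain ⟨f, l, hf, hl0, hl1, hlA⟩ := hi.exists_lift_of_homotopy_id G fA
    (K.comp ⟨fun b => (1, b), by fun_prop⟩) (fun a => by simp [hK'])
  simp only [ContinuousMap.coe_mk, ContinuousMap.comp_apply] at hl0 hl1 hlA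
  obtain ⟨h, hh0, hh1, hhA⟩ := hi.exists_top_of_square
    (K.comp ⟨fun w : I × B => (σ w.1, w.2), by fun_prop⟩) l
    ((q.comp g).comp ContinuousMap.snd) ⟨fun w : I × (I × A) => q (hA (w.1, w.2.2)), by fun_prop⟩
    (fun b => by simp [hl0]) (fun b => by simp [hK])
    (fun s a => by simp [hK']) (fun t a => by simp [hlA]) (fun t a => by simp)
  simp only [ContinuousMap.coe_mk, ContinuousMap.comp_apply, ContinuousMap.snd_apply] at hh1 hhA
  obtain ⟨k, hk0, hk1, hkA⟩ := hi.exists_top_of_square (p'.comp h)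
    ⟨fun w : I × B => H (w.1, p' (f w.2)), by fun_prop⟩
    ⟨fun w : I × B => H (w.1, g w.2), by fun_prop⟩
    ⟨fun w : I × (I × A) => H (w.2.1, hA (w.1, w.2.2)), by fun_prop⟩
    (fun b => by simp [hh0, hl1]) (fun b => by simp [hh1])
    (fun s a => by simp [hhA]) (fun t a => by simp [hf]) (fun t a => by simp)
  exact ⟨f, ⟨k, fun b => by simp [hk0], fun b => by simp [hk1]⟩, ContinuousMap.ext hf,
    fun t a => (hkA t a).trans (H.apply_one _)⟩

end

/-! ### Characterization of homotopy equivalences -/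

theorem proposition1 {X Y : Type u} [TopologicalSpace X] [TopologicalSpace Y] (p : C(X, Y)) :
    IsHomotopyEquivalence p ↔
      ∀ (A B : Type u) [TopologicalSpace A] [TopologicalSpace B] (i : C(A, B)),
        IsClosedCofibration i → HasHELP p i := by
  refine ⟨fun hp A B _ _ i hi => hi.cofibration.hasHELP hp, fun hp => ?_⟩
  obtain ⟨f, h, -, -⟩ := hp PEmpty.{u + 1} Y ⟨PEmpty.elim, continuous_of_discreteTopology⟩
    (isClosedCofibration_of_isEmpty _) ⟨PEmpty.elim, continuous_of_discreteTopology⟩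
    (ContinuousMap.id Y)
    ⟨⟨fun w => w.2.elim, continuous_iff_continuousAt.2 fun w => w.2.elim⟩,
      fun a => a.elim, fun a => a.elim⟩
  let hA : C(I × (X ⊕ X), Y) :=
    ContinuousMap.comp
      ⟨Sum.elim (fun w : I × X => h (w.1, p w.2)) (fun w : I × X => p w.2), by fun_prop⟩
      ⟨Homeomorph.prodSumDistrib, Homeomorph.continuous _⟩
  obtain ⟨k, -, hk, -⟩ := hp (X ⊕ X) (I × X) (cylinderEnds X) (isClosedCofibration_cylinderEnds X)
    ⟨Sum.elim (fun x => f (p x)) id, by fun_prop⟩ (p.comp ContinuousMap.snd)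
    ⟨hA, by rintro (x | x) <;> simp [hA, Homeomorph.prodSumDistrib, Homeomorph.sumCongr],
      by rintro (x | x) <;> simp [hA, cylinderEnds, Homeomorph.prodSumDistrib, Homeomorph.sumCongr]⟩
  refine ⟨⟨p, f, ⟨⟨k, fun x => ?_, fun x => ?_⟩⟩, ⟨h⟩⟩, rfl⟩
  · exact DFunLike.congr_fun hk (Sum.inl x)
  · exact DFunLike.congr_fun hk (Sum.inr x)
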